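/- Let $\mathbb T=\mathbb R/2\pi\mathbb Z$, and for $u\in L^2(\mathbb T)$ (complex-valued) let $\widehat u_k=\frac1{2\pi}\int_{-\pi}^{\pi}u(x)e^{-ikx}\,dx$, $k\in\mathbb Z$, be its Fourier coefficients. Let $\Pi$ be the orthogonal projection of $L^2(\mathbb T)$ onto $\operatorname{Im}\Pi=\{u:\widehat u_k=0\text{ for all }k<0\}$ and, for $n\ge 0$, let $\Pi_n$ be the orthogonal projection onto $\operatorname{Im}\Pi_n=\{u:\widehat u_k=0\text{ for all }k\notin\{0,\dots,n\}\}$. For a bounded measurable function $f$ on $\mathbb T$, let the Toeplitz operator $T(f)=\Pi f\Pi$ act on $\operatorname{Im}\Pi$ and its finite section $T_n(f)=\Pi_n f\,\Pi_n$ act on the $(n+1)$-dimensional space $\operatorname{Im}\Pi_n$, where $f$ also denotes the operator $u\mapsto fu$ on $L^2(\mathbb T)$; let $\sigma(A)$ denote the spectrum of an operator $A$ on the space on which it acts. **Theorem.** Let $f,g:\mathbb T\to\mathbb R$ be continuous with $g\ge 0$. For every $\lambda\in\mathbb R$ the following properties are equivalent: i) $\lambda\in\sigma(T(f)T(g))$;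 ii) there exist $\lambda_n\in\sigma(T_n(f)T_n(g))$, $n\in\mathbb N=\{0,1,2,\dots\}$, such that $\lambda_n\to\lambda$ as $n\to\infty$; iii) there exist a strictly increasing sequence $(N_k)_{k\in\mathbb N}$ of natural numbers and $\lambda_{N_k}\in\sigma(T_{N_k}(f)T_{N_k}(g))$ such that $\lambda_{N_k}\to\lambda$ as $k\to\infty$. -/

import Mathlib

open MeasureTheory Filter Topology
open scoped ENNReal Real

noncomputable section

namespace ToeplitzProduct

/-- The torus `ℝ / 2πℤ`. -/
abbrev Torus : Type := AddCircle (2 * π)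

instance factTwoPiPos : Fact (0 < 2 * π) := ⟨Real.two_pi_pos⟩

/-- The Haar probability measure `dx / 2π` on the torus. -/
abbrev torusMeasure : Measure Torus := AddCircle.haarAddCircle

/-- The Hilbert space `L²(𝕋)` of complex-valued functions. -/
abbrev L2 : Type := Lp ℂ 2 torusMeasure

/-- The operator `u ↦ φ u` of multiplication by `φ ∈ L^∞(𝕋)` on `L²(𝕋)`. -/
def mulOp (φ : Lp ℂ ∞ torusMeasure) : L2 →L[ℂ] L2 :=
  (ContinuousLinearMap.mul ℂ ℂ).holderL torusMeasure ∞ 2 2 φ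

/-- A real continuous function on the torus, seen as an element of the complex `L^∞(𝕋)`. -/
def symbol (f : C(Torus, ℝ)) : Lp ℂ ∞ torusMeasure :=
  ContinuousMap.toLp ∞ torusMeasure ℂ
    ((⟨fun t : ℝ => (t : ℂ), Complex.continuous_ofReal⟩ : C(ℝ, ℂ)).comp f)

/-- The functions of `L²(𝕋)` whose Fourier coefficients vanish outside the set `I` of
frequencies. -/
def modes (I : Set ℤ) : Submodule ℂ L2 where
  carrier := {u | ∀ k : ℤ, k ∉ I → fourierCoeff u k = 0}
  zero_mem' := fun k _ => by
    rw [← fourierBasis_repr, map_zero]; rfl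
  add_mem' := fun {u v} hu hv k hk => by
    have h1 := hu k hk
    have h2 := hv k hk
    rw [← fourierBasis_repr] at h1 h2 ⊢
    rw [map_add, lp.coeFn_add, Pi.add_apply, h1, h2, add_zero]
  smul_mem' := fun c u hu k hk => by
    have h1 := hu k hk
    rw [← fourierBasis_repr] at h1 ⊢
    rw [map_smul, lp.coeFn_smul, Pi.smul_apply, h1, smul_zero]

theorem isClosed_modes (I : Set ℤ) : IsClosed (modes I : Set L2) := by
  have h : (modes I : Set L2) =
      ⋂ k : ℤ, ⋂ _ : k ∉ I, {u : L2 | inner ℂ (fourierLp 2 k : L2) u = 0} := by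
    ext u
    simp only [Set.mem_iInter, Set.mem_ofPred_eq]
    refine forall_congr' fun k => forall_congr' fun _ => ?_
    rw [← fourierBasis_repr, HilbertBasis.repr_apply_apply, coe_fourierBasis]
  rw [h]
  exact isClosed_iInter fun k => isClosed_iInter fun _ =>
    isClosed_eq (continuous_const.inner continuous_id) continuous_const

instance completeSpace_modes (I : Set ℤ) : CompleteSpace (modes I) :=
  (isClosed_modes I).completeSpace_coe

/-- The operator `u ↦ P (φ u)` on `modes I`, where `P` is the orthogonal projection of `L²(𝕋)`
onto `modes I`. -/
def compression (I : Set ℤ) (φ : Lp ℂ ∞ torusMeasure) : modes I →L[ℂ] modes I :=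
  (modes I).orthogonalProjectionOnto ∘L mulOp φ ∘L (modes I).subtypeL

/-- The Toeplitz operator `T(f) = Π f Π`, acting on `Im Π`, the functions with frequencies
in `{0, 1, 2, …}`. -/
def toeplitz (f : C(Torus, ℝ)) : modes (Set.Ici 0) →L[ℂ] modes (Set.Ici 0) :=
  compression (Set.Ici 0) (symbol f)

/-- The finite section `T_n(f) = Π_n f Π_n`, acting on `Im Π_n`, the functions with frequencies
in `{0, …, n}`. -/
def toeplitzSection (n : ℕ) (f : C(Torus, ℝ)) :
    modes (Set.Icc 0 (n : ℤ)) →L[ℂ] modes (Set.Icc 0 (n : ℤ)) :=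
  compression (Set.Icc 0 (n : ℤ)) (symbol f)

end ToeplitzProduct

end

/-!
The idea of the proof.

*Spectrum of the limit is approximated.* Write `A = T_n(f)` and `B = T_n(g)`, with `B ≥ 0`. The
product `A * B` need not be normal, but with `C = √B` it has the spectrum of the self-adjoint
`C * A * C`, and this makes up for it: if the spectrum stays at distance `δ` from `lam`, then
`A * B - lam` is bounded below by a constant that depends only on `lam`, `δ`, `‖A‖` and `‖B‖`, not
on the dimension (`exists_pos_forall_mul_norm_le_mul_sub_smul`). This covers `lam = 0`, where both
factors are invertible. In finite dimensions the bound passes to the adjoint `B * A - lam`. The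
sections converge strongly, so if the distance from `lam` to their spectra does not tend to `0`, then
`T(f) T(g) - lam` and its adjoint are bounded below, that is, `lam` is not in the spectrum
(`exists_tendsto_of_mem_spectrum`). No square root is taken in the limit.

*No spurious limits.* Let `u` be a unit eigenvector of `T_N(f) T_N(g)`. A cutoff in frequency that
decreases linearly from `1` at `0` to `0` just above `N` has slope of order `1 / N`, so its
commutators with multiplications by continuous functions tend to `0` in norm
(`tendsto_norm_commutator`). As the cutoff vanishes above `N`, the cut off eigenvector is an
approximate eigenvector of `T(f) T(g)`, provided that it is not small
(`norm_cutoff_sub_smul_le`). If it is small, then `u` lives near the frequency `N`. The antilinear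
reflection `u ↦ e^{iNx} ū` commutes with the finite sections, since the symbols are real, and
exchanges the two ends of `{0, …, N}`; so the same argument applies to the reflected eigenvector,
whose eigenvalue is the complex conjugate (`exists_approximate_eigenvector`).
-/

namespace ToeplitzProduct

/-! ### Lower bounds for products of operators on a Hilbert space -/

section Hilbert

open ContinuousLinearMap

universe u

theorem mem_spectrum_iff_exists_eigenvector {E : Type u} [NormedAddCommGroup E] [NormedSpace ℂ E]
    [FiniteDimensional ℂ E] (T : E →L[ℂ] E) (z : ℂ) :
    z ∈ spectrum ℂ T ↔ ∃ v : E, v ≠ 0 ∧ T v = z • v := by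
  have : CompleteSpace E := FiniteDimensional.complete ℂ E
  rw [ContinuousLinearMap.spectrum_eq, ← Module.End.hasEigenvalue_iff_mem_spectrum]
  constructor
  · intro h
    obtain ⟨v, hv⟩ := h.exists_hasEigenvector
    exact ⟨v, hv.2, hv.apply_eq_smul⟩
  · rintro ⟨v, hv, h⟩
    exact Module.End.hasEigenvalue_of_hasEigenvector
      ⟨Module.End.mem_eigenspace_iff.2 h, hv⟩

/-- If `C * C = B`, the eigenvalues of the symmetrized product `C * A * C` belong to the spectrum of
`A * B`. In finite dimensions this includes the eigenvalue `0`. -/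
theorem mem_spectrum_mul_of_eigenvector {E : Type u} [NormedAddCommGroup E] [NormedSpace ℂ E]
    [FiniteDimensional ℂ E] (A C : E →L[ℂ] E) {z : ℂ} {w : E} (hw : w ≠ 0)
    (h : (C * A * C) w = z • w) : z ∈ spectrum ℂ (A * (C * C)) := by
  rw [mem_spectrum_iff_exists_eigenvector]
  by_cases h0 : A (C w) = 0
  · have hz : z = 0 := by
      have : z • w = 0 := by rw [← h]; simp [h0]
      simpa [hw] using this
    by_cases hC : Function.Injective C
    · obtain ⟨v, hv⟩ := (LinearMap.injective_iff_surjective (f := (C : E →ₗ[ℂ] E))).1 hC w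
      have hv : C v = w := hv
      refine ⟨v, ?_, by simp [hv, h0, hz]⟩
      rintro rfl
      exact hw (by simpa using hv.symm)
    · rw [injective_iff_map_eq_zero] at hC
      push Not at hC
      obtain ⟨v, hv, hv0⟩ := hC
      exact ⟨v, hv0, by simp [hv, hz]⟩
  · refine ⟨A (C w), h0, ?_⟩
    have h' : C (A (C w)) = z • w := h
    simp [h']

/-- The resolvent bound for a self-adjoint operator, read off in an orthonormal eigenbasis. -/
theorem mul_norm_le_norm_sub_smul_of_isSelfAdjoint {E : Type u} [NormedAddCommGroup E]
    [InnerProductSpace ℂ E] [FiniteDimensional ℂ E] [CompleteSpace E] {S : E →L[ℂ] E}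
    (hS : IsSelfAdjoint S)
    {z : ℂ} {δ : ℝ} (hδ : 0 ≤ δ) (h : ∀ θ ∈ spectrum ℂ S, δ ≤ ‖θ - z‖) (w : E) :
    δ * ‖w‖ ≤ ‖S w - z • w‖ := by
  have hsym : (S : E →ₗ[ℂ] E).IsSymmetric := hS.isSymmetric
  let b := hsym.eigenvectorBasis rfl
  have hb : ∀ i, S (b i) = (hsym.eigenvalues rfl i : ℂ) • b i :=
    fun i => hsym.apply_eigenvectorBasis rfl i
  have hcoord : ∀ i, inner ℂ (b i) (S w - z • w)
      = ((hsym.eigenvalues rfl i : ℂ) - z) * inner ℂ (b i) w := by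
    intro i
    have : inner ℂ (b i) (S w) = inner ℂ (S (b i)) w := (hsym (b i) w).symm
    rw [inner_sub_right, inner_smul_right, this, hb, inner_smul_left, Complex.conj_ofReal, sub_mul]
  have hδi : ∀ i, δ ≤ ‖(hsym.eigenvalues rfl i : ℂ) - z‖ := fun i =>
    h _ ((mem_spectrum_iff_exists_eigenvector S _).2 ⟨b i, b.orthonormal.ne_zero i, hb i⟩)
  have hsq : (δ * ‖w‖) ^ 2 ≤ ‖S w - z • w‖ ^ 2 := by
    rw [mul_pow, ← b.sum_sq_norm_inner_right w, ← b.sum_sq_norm_inner_right (S w - z • w),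
      Finset.mul_sum]
    refine Finset.sum_le_sum fun i _ => ?_
    rw [hcoord, norm_mul, mul_pow]
    have := hδi i
    gcongr
  exact le_of_sq_le_sq hsq (norm_nonneg _)

theorem exists_isSelfAdjoint_mul_self_eq {E : Type u} [NormedAddCommGroup E]
    [InnerProductSpace ℂ E] [CompleteSpace E] {B : E →L[ℂ] E} (hB : B.IsPositive) :
    ∃ C : E →L[ℂ] E, IsSelfAdjoint C ∧ C * C = B ∧ ∀ x, ‖C x‖ ≤ √‖B‖ * ‖x‖ := by
  have hB0 : 0 ≤ B := (nonneg_iff_isPositive B).2 hB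
  refine ⟨CFC.sqrt B, (CFC.sqrt_nonneg B).isSelfAdjoint, CFC.sqrt_mul_sqrt_self B hB0, fun x => ?_⟩
  set C := CFC.sqrt B with hC
  have hCC : C * C = B := CFC.sqrt_mul_sqrt_self B hB0
  have hCs : IsSelfAdjoint C := (CFC.sqrt_nonneg B).isSelfAdjoint
  have hn : ‖C‖ * ‖C‖ = ‖B‖ := by
    rw [← hCC, ← CStarRing.norm_star_mul_self (x := C), hCs.star_eq]
  have : √‖B‖ = ‖C‖ := by rw [← hn, Real.sqrt_mul_self (norm_nonneg _)]
  rw [this]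
  exact C.le_opNorm x

/-- A resolvent bound for the non-normal operator `A * B`, uniform in the dimension: if the spectrum
of `A * B` stays at distance `δ` from `z`, then `A * B - z` is bounded below by a constant that
depends only on `z`, `δ` and bounds for the norms of `A` and `B`. -/
theorem exists_pos_forall_mul_norm_le_mul_sub_smul (z : ℂ) (a b : ℝ) {δ : ℝ} (hδ : 0 < δ) :
    ∃ c : ℝ, 0 < c ∧ ∀ (E : Type u) [NormedAddCommGroup E] [InnerProductSpace ℂ E]
      [FiniteDimensional ℂ E] [CompleteSpace E] (A B : E →L[ℂ] E), IsSelfAdjoint A → B.IsPositive →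
      ‖A‖ ≤ a → ‖B‖ ≤ b → (∀ θ ∈ spectrum ℂ (A * B), δ ≤ ‖θ - z‖) →
      ∀ x, c * ‖x‖ ≤ ‖(A * B) x - z • x‖ := by
  refine ⟨if z = 0 then δ ^ 2 / (1 + |a| * |b|) else δ * ‖z‖ / (δ + |a| * |b|), ?_, ?_⟩
  · split_ifs with hz
    · positivity
    · have := norm_pos_iff.2 hz
      positivity
  intro E _ _ _ _ A B hA hB ha hb hspec x
  obtain ⟨C, hC, rfl, hCn⟩ := exists_isSelfAdjoint_mul_self_eq hB
  set s := √‖C * C‖ with hs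
  have hs0 : 0 ≤ s := Real.sqrt_nonneg _
  have hss : s * s ≤ |b| := by
    rw [hs, Real.mul_self_sqrt (norm_nonneg _)]
    exact hb.trans (le_abs_self b)
  have hA' : ∀ y, ‖A y‖ ≤ |a| * ‖y‖ := fun y =>
    (A.le_opNorm y).trans (by have := ha.trans (le_abs_self a); gcongr)
  have hS : IsSelfAdjoint (C * A * C) := by
    simpa [hC.star_eq] using hA.conjugate C
  have key : ∀ w, δ * ‖w‖ ≤ ‖(C * A * C) w - z • w‖ := by
    refine mul_norm_le_norm_sub_smul_of_isSelfAdjoint hS hδ.le fun θ hθ => hspec θ ?_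
    obtain ⟨w, hw, h⟩ := (mem_spectrum_iff_exists_eigenvector _ _).1 hθ
    exact mem_spectrum_mul_of_eigenvector A C hw h
  set X := ‖(A * (C * C)) x - z • x‖ with hX
  -- `C` intertwines `A * (C * C)` with `C * A * C`.
  have h1 : δ * ‖C x‖ ≤ s * X := by
    refine (key (C x)).trans ?_
    have : (C * A * C) (C x) - z • C x = C ((A * (C * C)) x - z • x) := by
      simp
    rw [this]
    exact hCn _
  -- For `z = 0` the bound for `C * A * C` at `x` itself shows that `C` is bounded below.
  split_ifs with hz
  · subst hz
    have h2 : δ * ‖x‖ ≤ s * (|a| * ‖C x‖) := by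
      have := key x
      simp only [zero_smul, sub_zero] at this
      exact this.trans ((hCn _).trans (by gcongr; exact hA' _))
    rw [div_mul_eq_mul_div, div_le_iff₀ (by positivity)]
    have hX0 : 0 ≤ X := norm_nonneg _
    calc δ ^ 2 * ‖x‖ = δ * (δ * ‖x‖) := by ring
      _ ≤ δ * (s * (|a| * ‖C x‖)) := by gcongr
      _ = s * |a| * (δ * ‖C x‖) := by ring
      _ ≤ s * |a| * (s * X) := by gcongr
      _ = (s * s) * (|a| * X) := by ring
      _ ≤ |b| * (|a| * X) := by gcongr
      _ ≤ X * (1 + |a| * |b|) := by linarith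
  -- For `z ≠ 0`, `z • x` is recovered from `A * B` at `x`, which `‖C x‖` controls.
  · have h2 : ‖z‖ * ‖x‖ ≤ X + |a| * (s * ‖C x‖) := by
      have e : z • x = A (C (C x)) - ((A * (C * C)) x - z • x) := by
        simp
      rw [← norm_smul, e, add_comm]
      refine (norm_sub_le _ _).trans ?_
      gcongr
      exact (hA' _).trans (by gcongr; exact hCn _)
    have hX0 : 0 ≤ X := norm_nonneg _
    rw [div_mul_eq_mul_div, div_le_iff₀ (by positivity)]
    calc δ * ‖z‖ * ‖x‖ = δ * (‖z‖ * ‖x‖) := by ring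
      _ ≤ δ * (X + |a| * (s * ‖C x‖)) := by gcongr
      _ = δ * X + |a| * s * (δ * ‖C x‖) := by ring
      _ ≤ δ * X + |a| * s * (s * X) := by gcongr
      _ = δ * X + (s * s) * (|a| * X) := by ring
      _ ≤ δ * X + |b| * (|a| * X) := by gcongr
      _ = X * (δ + |a| * |b|) := by ring

/-- In finite dimensions a lower bound passes to the adjoint, with the same constant. -/
theorem mul_norm_le_norm_adjoint {E : Type u} [NormedAddCommGroup E] [InnerProductSpace ℂ E]
    [FiniteDimensional ℂ E] [CompleteSpace E] {S : E →L[ℂ] E} {c : ℝ} (hc : 0 < c)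
    (h : ∀ x, c * ‖x‖ ≤ ‖S x‖) (x : E) : c * ‖x‖ ≤ ‖adjoint S x‖ := by
  have hinj : Function.Injective (S : E →ₗ[ℂ] E) := by
    rw [injective_iff_map_eq_zero]
    intro y hy
    have := h y
    rw [show S y = 0 from hy, norm_zero] at this
    exact norm_le_zero_iff.1 (nonpos_of_mul_nonpos_right this hc)
  obtain ⟨y, hy⟩ := LinearMap.injective_iff_surjective.1 hinj x
  have hy : S y = x := hy
  rcases eq_or_ne x 0 with rfl | hx
  · simp
  have hx0 : 0 < ‖x‖ := norm_pos_iff.2 hx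
  have h1 : ‖x‖ * ‖x‖ ≤ ‖adjoint S x‖ * ‖y‖ := by
    have h3 : ‖inner ℂ x (S y)‖ = ‖x‖ * ‖x‖ := by
      rw [hy, inner_self_eq_norm_sq_to_K]
      simp [sq]
    rw [← h3, ← adjoint_inner_left]
    exact norm_inner_le_norm _ _
  have h2 : c * ‖y‖ ≤ ‖x‖ := hy ▸ h y
  refine le_of_mul_le_mul_right ?_ hx0
  calc c * ‖x‖ * ‖x‖ = c * (‖x‖ * ‖x‖) := by ring
    _ ≤ c * (‖adjoint S x‖ * ‖y‖) := by gcongr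
    _ = ‖adjoint S x‖ * (c * ‖y‖) := by ring
    _ ≤ ‖adjoint S x‖ * ‖x‖ := by gcongr

theorem isUnit_of_mul_norm_le_of_mul_norm_le_adjoint {E : Type u} [NormedAddCommGroup E]
    [InnerProductSpace ℂ E] [CompleteSpace E] {S : E →L[ℂ] E} {c : ℝ} (hc : 0 < c)
    (h : ∀ x, c * ‖x‖ ≤ ‖S x‖) (h' : ∀ x, c * ‖x‖ ≤ ‖adjoint S x‖) : IsUnit S := by
  rw [isUnit_iff_bijective, bijective_iff_dense_range_and_antilipschitz]
  constructor
  · rw [Submodule.topologicalClosure_eq_top_iff, orthogonal_range, Submodule.eq_bot_iff]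
    intro y hy
    have := h' y
    rw [show adjoint S y = 0 from hy, norm_zero] at this
    exact norm_le_zero_iff.1 (nonpos_of_mul_nonpos_right this hc)
  · refine ⟨(⟨c⁻¹, by positivity⟩ : NNReal), ContinuousLinearMap.antilipschitz_of_bound _ fun x => ?_⟩
    have := h x
    change ‖x‖ ≤ c⁻¹ * ‖S x‖
    rwa [inv_mul_eq_div, le_div_iff₀ hc, mul_comm]

theorem exists_pos_mul_norm_le_of_isUnit {E : Type u} [NormedAddCommGroup E]
    [NormedSpace ℂ E] {S : E →L[ℂ] E} (hS : IsUnit S) :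
    ∃ c : ℝ, 0 < c ∧ ∀ x, c * ‖x‖ ≤ ‖S x‖ := by
  obtain ⟨U, rfl⟩ := hS
  refine ⟨(1 + ‖((U⁻¹ : (E →L[ℂ] E)ˣ) : E →L[ℂ] E)‖)⁻¹, by positivity, fun x => ?_⟩
  rw [inv_mul_le_iff₀ (by positivity)]
  have h1 : ((U⁻¹ : (E →L[ℂ] E)ˣ) : E →L[ℂ] E) ((U : E →L[ℂ] E) x) = x := by
    change ((U⁻¹ * U : (E →L[ℂ] E)ˣ) : E →L[ℂ] E) x = x
    simp
  have h2 := ((U⁻¹ : (E →L[ℂ] E)ˣ) : E →L[ℂ] E).le_opNorm ((U : E →L[ℂ] E) x)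
  rw [h1] at h2
  nlinarith [norm_nonneg ((U : E →L[ℂ] E) x)]

theorem exists_closest_mem_spectrum {E : Type u} [NormedAddCommGroup E] [NormedSpace ℂ E]
    [CompleteSpace E] [Nontrivial E] (T : E →L[ℂ] E) (z : ℂ) :
    ∃ μ ∈ spectrum ℂ T, ∀ θ ∈ spectrum ℂ T, ‖μ - z‖ ≤ ‖θ - z‖ :=
  (spectrum.isCompact T).exists_isMinOn (spectrum.nonempty T)
    (continuous_id.sub continuous_const).norm.continuousOn

theorem algebraMap_sub_apply {E : Type u} [NormedAddCommGroup E] [NormedSpace ℂ E]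
    (T : E →L[ℂ] E) (z : ℂ) (x : E) :
    (algebraMap ℂ (E →L[ℂ] E) z - T) x = -(T x - z • x) := by
  rw [neg_sub]
  rfl

theorem adjoint_algebraMap_sub_mul {E : Type u} [NormedAddCommGroup E] [InnerProductSpace ℂ E]
    [CompleteSpace E] {A B : E →L[ℂ] E} (hA : IsSelfAdjoint A) (hB : IsSelfAdjoint B) (lam : ℝ) :
    adjoint (algebraMap ℂ (E →L[ℂ] E) lam - A * B) = algebraMap ℂ (E →L[ℂ] E) lam - B * A := by
  rw [← star_eq_adjoint, star_sub, star_mul, hA.star_eq, hB.star_eq, ← algebraMap_star_comm,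
    Complex.star_def, Complex.conj_ofReal]

theorem mul_norm_le_mul_comm_sub_smul {E : Type u} [NormedAddCommGroup E] [InnerProductSpace ℂ E]
    [FiniteDimensional ℂ E] [CompleteSpace E] {A B : E →L[ℂ] E} (hA : IsSelfAdjoint A)
    (hB : IsSelfAdjoint B) {lam c : ℝ} (hc : 0 < c)
    (h : ∀ x, c * ‖x‖ ≤ ‖(A * B) x - (lam : ℂ) • x‖) (x : E) :
    c * ‖x‖ ≤ ‖(B * A) x - (lam : ℂ) • x‖ := by
  have := mul_norm_le_norm_adjoint (S := algebraMap ℂ (E →L[ℂ] E) lam - A * B) hc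
    (fun y => by rw [algebraMap_sub_apply, norm_neg]; exact h y) x
  rwa [adjoint_algebraMap_sub_mul hA hB, algebraMap_sub_apply, norm_neg] at this

theorem notMem_spectrum_mul {E : Type u} [NormedAddCommGroup E] [InnerProductSpace ℂ E]
    [CompleteSpace E] {A B : E →L[ℂ] E} (hA : IsSelfAdjoint A) (hB : IsSelfAdjoint B) {lam c : ℝ}
    (hc : 0 < c) (h : ∀ x, c * ‖x‖ ≤ ‖(A * B) x - (lam : ℂ) • x‖)
    (h' : ∀ x, c * ‖x‖ ≤ ‖(B * A) x - (lam : ℂ) • x‖) : (lam : ℂ) ∉ spectrum ℂ (A * B) := by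
  rw [spectrum.notMem_iff]
  refine isUnit_of_mul_norm_le_of_mul_norm_le_adjoint hc (fun x => ?_) fun x => ?_
  · rw [algebraMap_sub_apply, norm_neg]
    exact h x
  · rw [adjoint_algebraMap_sub_mul hA hB, algebraMap_sub_apply, norm_neg]
    exact h' x

end Hilbert

/-! ### Fourier coefficients, multiplication operators and compressions -/

/-- The `k`-th Fourier coefficient, as a continuous linear functional on `L²(𝕋)`. -/
noncomputable def coeff (k : ℤ) : L2 →L[ℂ] ℂ := innerSL ℂ (fourierLp 2 k : L2)

theorem coeff_apply (k : ℤ) (u : L2) : coeff k u = fourierCoeff u k := by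
  rw [← fourierBasis_repr, HilbertBasis.repr_apply_apply, coe_fourierBasis]
  rfl

theorem ext_coeff {u v : L2} (h : ∀ k, coeff k u = coeff k v) : u = v := by
  apply fourierBasis.repr.injective
  ext k
  rw [fourierBasis_repr, fourierBasis_repr, ← coeff_apply, ← coeff_apply, h]

theorem mem_modes_iff {I : Set ℤ} {u : L2} : u ∈ modes I ↔ ∀ k, k ∉ I → coeff k u = 0 := by
  simp only [coeff_apply]
  rfl

theorem coeff_fourierLp (k m : ℤ) :
    coeff k (fourierLp 2 m : L2) = if k = m then 1 else 0 :=
  orthonormal_iff_ite.1 (orthonormal_fourier (T := 2 * π)) k m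

theorem fourierLp_mem_modes {I : Set ℤ} {k : ℤ} (hk : k ∈ I) :
    (fourierLp 2 k : L2) ∈ modes I := by
  rw [mem_modes_iff]
  intro j hj
  rw [coeff_fourierLp, if_neg]
  rintro rfl
  exact hj hk

open scoped Classical in
theorem coeff_starProjection (I : Set ℤ) (u : L2) (k : ℤ) :
    coeff k ((modes I).starProjection u) = if k ∈ I then coeff k u else 0 := by
  split_ifs with hk
  · have h := Submodule.sub_starProjection_mem_orthogonal (K := modes I) u _ (fourierLp_mem_modes hk)
    have h' : coeff k (u - (modes I).starProjection u) = 0 := h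
    rw [map_sub, sub_eq_zero] at h'
    exact h'.symm
  · exact mem_modes_iff.1 (Submodule.starProjection_apply_mem (modes I) u) k hk

instance finiteDimensional_modes_Icc (a b : ℤ) : FiniteDimensional ℂ (modes (Set.Icc a b)) := by
  let F : modes (Set.Icc a b) →ₗ[ℂ] (Set.Icc a b → ℂ) :=
    LinearMap.pi fun k => (coeff k : L2 →ₗ[ℂ] ℂ) ∘ₗ (modes (Set.Icc a b)).subtype
  refine FiniteDimensional.of_injective F fun u v h => Subtype.ext (ext_coeff fun k => ?_)
  by_cases hk : k ∈ Set.Icc a b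
  · exact congr_fun h ⟨k, hk⟩
  · rw [mem_modes_iff.1 u.2 k hk, mem_modes_iff.1 v.2 k hk]

instance nontrivial_modes_Icc (n : ℕ) : Nontrivial (modes (Set.Icc 0 (n : ℤ))) := by
  refine ⟨⟨⟨fourierLp 2 0, fourierLp_mem_modes (by simp)⟩, 0, fun h => ?_⟩⟩
  have h1 := congr_arg (fun u : modes (Set.Icc 0 (n : ℤ)) => coeff 0 (u : L2)) h
  simp [coeff_fourierLp] at h1

/-- `Π_n` converges strongly to `Π`. -/
theorem tendsto_starProjection_modes_Icc (u : L2) :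
    Tendsto (fun n : ℕ => (modes (Set.Icc 0 (n : ℤ))).starProjection u) atTop
      (𝓝 ((modes (Set.Ici 0)).starProjection u)) := by
  have hmono : Monotone fun n : ℕ => modes (Set.Icc 0 (n : ℤ)) := fun m n hmn v hv =>
    mem_modes_iff.2 fun k hk => mem_modes_iff.1 hv k fun hk' =>
      hk ⟨hk'.1, hk'.2.trans (by exact_mod_cast hmn)⟩
  have hcl : (⨆ n : ℕ, modes (Set.Icc 0 (n : ℤ))).topologicalClosure = modes (Set.Ici 0) := by
    apply le_antisymm
    · refine Submodule.topologicalClosure_minimal _ (iSup_le fun n v hv => ?_) (isClosed_modes _)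
      exact mem_modes_iff.2 fun k hk => mem_modes_iff.1 hv k fun hk' => hk hk'.1
    · intro v hv
      refine mem_closure_of_tendsto (hasSum_fourier_series_L2 v)
        (Eventually.of_forall fun s => Submodule.sum_mem _ fun k _ => ?_)
      by_cases hk : k ∈ Set.Ici (0 : ℤ)
      · refine Submodule.smul_mem _ _ (Submodule.mem_iSup_of_mem k.toNat (fourierLp_mem_modes ?_))
        exact ⟨hk, Int.self_le_toNat k⟩
      · rw [← coeff_apply, mem_modes_iff.1 hv k hk, zero_smul]
        exact Submodule.zero_mem _
  have : CompleteSpace (⨆ n : ℕ, modes (Set.Icc 0 (n : ℤ))).topologicalClosure :=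
    (Submodule.isClosed_topologicalClosure _).completeSpace_coe
  have h := Submodule.starProjection_tendsto_closure_iSup
    (fun n : ℕ => modes (Set.Icc 0 (n : ℤ))) hmono u
  convert h using 3
  congr! 1
  exact hcl.symm

/-- Multiplication by continuous functions, as a continuous linear map into the operators on
`L²(𝕋)`. -/
noncomputable def mulL : C(Torus, ℂ) →L[ℂ] L2 →L[ℂ] L2 :=
  (ContinuousLinearMap.mul ℂ ℂ).holderL torusMeasure ∞ 2 2 ∘L ContinuousMap.toLp ∞ torusMeasure ℂ

theorem coeFn_mulL (φ : C(Torus, ℂ)) (u : L2) :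
    mulL φ u =ᵐ[torusMeasure] fun x => φ x * u x := by
  have h1 := (ContinuousLinearMap.mul ℂ ℂ).coeFn_holder (r := 2)
    (ContinuousMap.toLp ∞ torusMeasure ℂ φ) u
  have h2 := ContinuousMap.coeFn_toLp (p := ∞) (𝕜 := ℂ) torusMeasure φ
  filter_upwards [h1, h2] with x hx1 hx2
  rw [← hx2]
  exact hx1

/-- A real continuous function, seen as a complex one. -/
noncomputable def complexify (f : C(Torus, ℝ)) : C(Torus, ℂ) :=
  (⟨fun t : ℝ => (t : ℂ), Complex.continuous_ofReal⟩ : C(ℝ, ℂ)).comp f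

theorem complexify_apply (f : C(Torus, ℝ)) (x : Torus) : complexify f x = f x := rfl

theorem mulOp_symbol (f : C(Torus, ℝ)) : mulOp (symbol f) = mulL (complexify f) := rfl

theorem coeff_mulL_fourier (m k : ℤ) (u : L2) :
    coeff k (mulL (fourier m) u) = coeff (k - m) u := by
  rw [coeff_apply, coeff_apply, fourierCoeff_congr_ae (coeFn_mulL _ u)]
  unfold fourierCoeff
  refine integral_congr_ae (Eventually.of_forall fun x => ?_)
  simp only [smul_eq_mul]
  rw [← mul_assoc, ← fourier_add, show -k + m = -(k - m) by ring]

theorem inner_mulL_complexify_left (f : C(Torus, ℝ)) (u v : L2) :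
    inner ℂ (mulL (complexify f) u) v = inner ℂ u (mulL (complexify f) v) := by
  rw [L2.inner_def, L2.inner_def]
  refine integral_congr_ae ?_
  filter_upwards [coeFn_mulL (complexify f) u, coeFn_mulL (complexify f) v] with x h1 h2
  rw [h1, h2]
  simp [complexify_apply]
  ring

theorem isSelfAdjoint_mulL_complexify (f : C(Torus, ℝ)) : IsSelfAdjoint (mulL (complexify f)) := by
  rw [ContinuousLinearMap.isSelfAdjoint_iff_isSymmetric]
  exact inner_mulL_complexify_left f

theorem isPositive_mulL_complexify {g : C(Torus, ℝ)} (hg : ∀ x, 0 ≤ g x) :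
    (mulL (complexify g)).IsPositive := by
  rw [ContinuousLinearMap.isPositive_def']
  refine ⟨isSelfAdjoint_mulL_complexify g, fun u => ?_⟩
  rw [ContinuousLinearMap.reApplyInnerSelf_apply, L2.inner_def, ← integral_re (L2.integrable_inner _ _)]
  refine integral_nonneg_of_ae ?_
  filter_upwards [coeFn_mulL (complexify g) u] with x h1
  rw [h1]
  have : inner ℂ (complexify g x * u x) (u x) = ((g x * ‖u x‖ ^ 2 : ℝ) : ℂ) := by
    rw [complexify_apply, RCLike.inner_apply, map_mul, Complex.conj_ofReal, mul_left_comm,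
      Complex.mul_conj, Complex.normSq_eq_norm_sq, Complex.ofReal_mul]
  rw [this, RCLike.re_eq_complex_re, Complex.ofReal_re]
  exact mul_nonneg (hg x) (sq_nonneg _)

theorem compression_eq (I : Set ℤ) (f : C(Torus, ℝ)) :
    compression I (symbol f) =
      ContinuousLinearMap.adjoint (modes I).subtypeL ∘L mulL (complexify f) ∘L
        (modes I).subtypeL := by
  rw [compression, mulOp_symbol, Submodule.adjoint_subtypeL]

theorem isSelfAdjoint_compression (I : Set ℤ) (f : C(Torus, ℝ)) :
    IsSelfAdjoint (compression I (symbol f)) := by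
  rw [compression_eq]
  exact (isSelfAdjoint_mulL_complexify f).adjoint_conj _

theorem isPositive_compression (I : Set ℤ) {g : C(Torus, ℝ)} (hg : ∀ x, 0 ≤ g x) :
    (compression I (symbol g)).IsPositive := by
  rw [compression_eq]
  exact (isPositive_mulL_complexify hg).adjoint_conj _

theorem norm_compression_le (I : Set ℤ) (f : C(Torus, ℝ)) :
    ‖compression I (symbol f)‖ ≤ ‖mulL (complexify f)‖ := by
  refine ContinuousLinearMap.opNorm_le_bound _ (norm_nonneg _) fun u => ?_
  change ‖(modes I).orthogonalProjectionOnto (mulL (complexify f) u)‖ ≤ _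
  refine ((modes I).norm_orthogonalProjectionOnto_apply_le _).trans ?_
  exact (mulL (complexify f)).le_opNorm (u : L2)

theorem norm_compression_mul_sub_smul (I : Set ℤ) (f g : C(Torus, ℝ)) (z : ℂ) (u : modes I) :
    ‖(compression I (symbol f) * compression I (symbol g)) u - z • u‖ =
      ‖(modes I).starProjection (mulL (complexify f)
        ((modes I).starProjection (mulL (complexify g) u))) - z • (u : L2)‖ := rfl

/-! ### The cutoff in frequency and the reflection -/

/-- The cutoff in frequency that equals `1` on the frequencies `k ≤ 0`, decreases linearly on
`{0, …, N + 1}` and vanishes for `k > N`, written as a mean of orthogonal projections. -/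
noncomputable def cutoff (N : ℕ) : L2 →L[ℂ] L2 :=
  ((N : ℂ) + 1)⁻¹ • ∑ a ∈ Finset.range (N + 1), (modes (Set.Iic (a : ℤ))).starProjection

/-- The multiplier by which `cutoff N` acts on the `k`-th Fourier coefficient. -/
noncomputable def cutoffWeight (N : ℕ) (k : ℤ) : ℝ :=
  ((N : ℝ) + 1)⁻¹ * ((Finset.range (N + 1)).filter fun a : ℕ => k ≤ a).card

theorem coeff_cutoff (N : ℕ) (u : L2) (k : ℤ) :
    coeff k (cutoff N u) = cutoffWeight N k * coeff k u := by
  simp only [cutoff, smul_apply, sum_apply, map_smul,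
    map_sum, coeff_starProjection, Set.mem_Iic, cutoffWeight]
  rw [← Finset.sum_filter, Finset.sum_const]
  simp [mul_assoc]

theorem cutoffWeight_of_lt {N : ℕ} {k : ℤ} (hk : (N : ℤ) < k) : cutoffWeight N k = 0 := by
  have : (Finset.range (N + 1)).filter (fun a : ℕ => k ≤ a) = ∅ := by
    ext a
    simp
    omega
  simp [cutoffWeight, this]

/-- On `{0, …, N}` the weight at `k` is `(N + 1 - k) / (N + 1)`. -/
theorem cutoffWeight_add_reflect {N : ℕ} {k : ℤ} (h0 : 0 ≤ k) (hk : k ≤ N) :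
    cutoffWeight N k + cutoffWeight N (N - k) = 1 + ((N : ℝ) + 1)⁻¹ := by
  have card : ∀ j : ℕ, ((Finset.range (N + 1)).filter fun a : ℕ => (j : ℤ) ≤ a).card
      = N + 1 - j := by
    intro j
    rw [← Nat.card_Ico]
    congr 1
    ext a
    simp
    omega
  lift k to ℕ using h0
  have hk' : k ≤ N := by exact_mod_cast hk
  obtain ⟨j, rfl⟩ := Nat.exists_eq_add_of_le hk'
  have e : ((k + j : ℕ) : ℤ) - k = (j : ℕ) := by push_cast; ring
  rw [cutoffWeight, cutoffWeight, e, card, card, ← mul_add, ← Nat.cast_add,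
    show k + j + 1 - k + (k + j + 1 - j) = (k + j + 1) + 1 by omega]
  push_cast
  field_simp

theorem starProjection_Ici_cutoff (N : ℕ) (u : L2) :
    (modes (Set.Ici 0)).starProjection (cutoff N u) =
      cutoff N ((modes (Set.Ici 0)).starProjection u) := by
  refine ext_coeff fun k => ?_
  simp only [coeff_starProjection, coeff_cutoff, mul_ite, mul_zero]

/-- Since the cutoff vanishes above `N`, it does not distinguish `Π` from `Π_N`. -/
theorem cutoff_starProjection_Ici (N : ℕ) (u : L2) :
    cutoff N ((modes (Set.Ici 0)).starProjection u) =
      cutoff N ((modes (Set.Icc 0 (N : ℤ))).starProjection u) := by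
  refine ext_coeff fun k => ?_
  simp only [coeff_starProjection, coeff_cutoff, Set.mem_Ici, Set.mem_Icc]
  by_cases h : k ≤ N
  · simp [h]
  · simp [cutoffWeight_of_lt (not_le.1 h)]

theorem cutoff_mem_modes {I : Set ℤ} (N : ℕ) {u : L2} (hu : u ∈ modes I) :
    cutoff N u ∈ modes I :=
  mem_modes_iff.2 fun k hk => by rw [coeff_cutoff, mem_modes_iff.1 hu k hk, mul_zero]

theorem norm_cutoff_le (N : ℕ) : ‖cutoff N‖ ≤ 1 := by
  have h : ‖∑ a ∈ Finset.range (N + 1), (modes (Set.Iic (a : ℤ))).starProjection‖ ≤ N + 1 := by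
    refine (norm_sum_le_of_le _ fun a _ => Submodule.starProjection_norm_le _).trans ?_
    simp
  have hN : ‖((N : ℂ) + 1)⁻¹‖ = ((N : ℝ) + 1)⁻¹ := by
    rw [norm_inv]
    norm_cast
  rw [cutoff, norm_smul, hN, inv_mul_le_iff₀ (by positivity), mul_one]
  exact h

/-- The commutator of the cutoff with the multiplication by `φ`. -/
noncomputable def commutator (N : ℕ) (φ : C(Torus, ℂ)) : L2 →L[ℂ] L2 :=
  cutoff N ∘L mulL φ - mulL φ ∘L cutoff N

theorem norm_commutator_le (N : ℕ) (φ : C(Torus, ℂ)) :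
    ‖commutator N φ‖ ≤ 2 * ‖mulL‖ * ‖φ‖ := by
  have h := mulL.le_opNorm φ
  have hN := norm_cutoff_le N
  have h0 := norm_nonneg (mulL φ)
  refine (norm_sub_le _ _).trans ?_
  have h1 : ‖cutoff N ∘L mulL φ‖ ≤ 1 * ‖mulL φ‖ :=
    (ContinuousLinearMap.opNorm_comp_le _ _).trans (by gcongr)
  have h2 : ‖mulL φ ∘L cutoff N‖ ≤ ‖mulL φ‖ * 1 :=
    (ContinuousLinearMap.opNorm_comp_le _ _).trans (by gcongr)
  linarith

theorem norm_sum_starProjection_shift_sub_le (N : ℕ) (m : ℤ) :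
    ‖∑ a ∈ Finset.range (N + 1), (modes (Set.Iic ((a : ℤ) - m))).starProjection -
      ∑ a ∈ Finset.range (N + 1), (modes (Set.Iic (a : ℤ))).starProjection‖ ≤ 2 * |(m : ℝ)| := by
  -- Consecutive shifts differ by a telescoping sum, of which two projections remain.
  have step : ∀ j : ℤ,
      ‖∑ a ∈ Finset.range (N + 1), (modes (Set.Iic ((a : ℤ) - (j + 1)))).starProjection -
        ∑ a ∈ Finset.range (N + 1), (modes (Set.Iic ((a : ℤ) - j))).starProjection‖ ≤ 2 := by
    intro j
    let F : ℕ → (L2 →L[ℂ] L2) := fun i => (modes (Set.Iic ((i : ℤ) - (j + 1)))).starProjection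
    have hF : ∀ i : ℕ, (modes (Set.Iic ((i : ℤ) - j))).starProjection = F (i + 1) := fun i => by
      simp only [F]
      congr! 3
      push_cast
      ring
    simp only [hF]
    rw [← Finset.sum_sub_distrib]
    change ‖∑ i ∈ Finset.range (N + 1), (F i - F (i + 1))‖ ≤ 2
    rw [Finset.sum_range_sub']
    refine (norm_sub_le _ _).trans ?_
    have h1 : ∀ i, ‖F i‖ ≤ 1 := fun i => Submodule.starProjection_norm_le _
    linarith [h1 0, h1 (N + 1)]
  induction m using Int.induction_on with
  | zero => simp
  | succ i ih =>
    refine (norm_sub_le_norm_sub_add_norm_sub _ (∑ a ∈ Finset.range (N + 1),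
      (modes (Set.Iic ((a : ℤ) - i))).starProjection) _).trans ?_
    have := step i
    push_cast at ih ⊢
    rw [abs_of_nonneg (by positivity)] at ih ⊢
    linarith
  | pred i ih =>
    refine (norm_sub_le_norm_sub_add_norm_sub _ (∑ a ∈ Finset.range (N + 1),
      (modes (Set.Iic ((a : ℤ) - (-i)))).starProjection) _).trans ?_
    have := step (-i - 1)
    rw [sub_add_cancel, norm_sub_rev] at this
    push_cast at ih ⊢
    rw [abs_neg, abs_of_nonneg (by positivity)] at ih
    rw [abs_of_nonpos (by linarith [(Nat.cast_nonneg i : (0 : ℝ) ≤ i)])]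
    linarith

theorem norm_commutator_fourier_le (N : ℕ) (m : ℤ) :
    ‖commutator N (fourier m)‖ ≤
      ‖mulL (fourier m : C(Torus, ℂ))‖ * (2 * |(m : ℝ)|) * ((N : ℝ) + 1)⁻¹ := by
  -- Multiplication by `e^{imx}` shifts the frequencies, hence the projections, by `m`.
  have e : commutator N (fourier m) = ((N : ℂ) + 1)⁻¹ • (mulL (fourier m) ∘L
      (∑ a ∈ Finset.range (N + 1), (modes (Set.Iic ((a : ℤ) - m))).starProjection -
        ∑ a ∈ Finset.range (N + 1), (modes (Set.Iic (a : ℤ))).starProjection)) := by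
    ext1 u
    refine ext_coeff fun k => ?_
    simp only [commutator, cutoff, sub_apply, ContinuousLinearMap.comp_apply,
      smul_apply, sum_apply, map_sub, map_smul, map_sum,
      coeff_starProjection, coeff_mulL_fourier, Set.mem_Iic, sub_le_sub_iff_right, smul_sub]
  have hN : ‖((N : ℂ) + 1)⁻¹‖ = ((N : ℝ) + 1)⁻¹ := by
    rw [norm_inv]
    norm_cast
  rw [e, norm_smul, hN, mul_comm]
  gcongr
  refine (ContinuousLinearMap.opNorm_comp_le _ _).trans ?_
  gcongr
  exact norm_sum_starProjection_shift_sub_le N m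

/-- The cutoff varies slowly, so it asymptotically commutes with every trigonometric polynomial,
and then with every continuous function. -/
theorem tendsto_norm_commutator (φ : C(Torus, ℂ)) :
    Tendsto (fun N => ‖commutator N φ‖) atTop (𝓝 0) := by
  have hspan : ∀ ψ ∈ Submodule.span ℂ (Set.range (@fourier (2 * π))),
      Tendsto (fun N => ‖commutator N ψ‖) atTop (𝓝 0) := by
    intro ψ hψ
    induction hψ using Submodule.span_induction with
    | mem ψ h =>
      obtain ⟨m, rfl⟩ := h
      refine squeeze_zero (fun _ => norm_nonneg _) (fun N => norm_commutator_fourier_le N m) ?_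
      have h := (tendsto_one_div_add_atTop_nhds_zero_nat (𝕜 := ℝ)).const_mul
        (‖mulL (fourier m : C(Torus, ℂ))‖ * (2 * |(m : ℝ)|))
      simpa only [one_div, mul_zero] using h
    | zero => simp [commutator]
    | add ψ₁ ψ₂ _ _ h₁ h₂ =>
      refine squeeze_zero (fun _ => norm_nonneg _) (fun N => ?_) (by simpa using h₁.add h₂)
      have : commutator N (ψ₁ + ψ₂) = commutator N ψ₁ + commutator N ψ₂ := by
        simp only [commutator, map_add, ContinuousLinearMap.comp_add, ContinuousLinearMap.add_comp]
        abel
      rw [this]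
      exact norm_add_le _ _
    | smul c ψ _ h =>
      have : ∀ N, commutator N (c • ψ) = c • commutator N ψ := fun N => by
        simp only [commutator, map_smul, ContinuousLinearMap.comp_smul,
          ContinuousLinearMap.smul_comp, smul_sub]
      simp only [this, norm_smul]
      simpa using h.const_mul ‖c‖
  have hφ : φ ∈ (Submodule.span ℂ (Set.range (@fourier (2 * π)))).topologicalClosure := by
    rw [span_fourier_closure_eq_top]
    trivial
  rw [Metric.tendsto_atTop]
  intro ε hε
  set K := 2 * ‖mulL‖ + 1 with hK
  have hK0 : 0 < K := by positivity
  obtain ⟨ψ, hψ, hd⟩ := Metric.mem_closure_iff.1 hφ (ε / (2 * K)) (by positivity)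
  obtain ⟨N₀, hN₀⟩ := Metric.tendsto_atTop.1 (hspan ψ hψ) (ε / 2) (by positivity)
  refine ⟨N₀, fun N hN => ?_⟩
  have h1 := hN₀ N hN
  rw [dist_zero_right, norm_norm] at h1 ⊢
  have h2 : ‖commutator N (φ - ψ)‖ ≤ K * (ε / (2 * K)) := by
    refine (norm_commutator_le N _).trans ?_
    rw [dist_eq_norm] at hd
    gcongr
    linarith
  have h3 : K * (ε / (2 * K)) = ε / 2 := by field_simp
  have h4 : commutator N φ = commutator N (φ - ψ) + commutator N ψ := by
    simp only [commutator, map_sub, ContinuousLinearMap.comp_sub, ContinuousLinearMap.sub_comp]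
    abel
  rw [h4]
  exact (norm_add_le _ _).trans_lt (by linarith)

/-- The antiunitary involution `u ↦ e^{iNx} ū`, which acts on Fourier coefficients by
`û_k ↦ conj û_{N-k}`. -/
noncomputable def reflect (N : ℕ) (u : L2) : L2 := mulL (fourier N) (star u)

theorem coeFn_reflect (N : ℕ) (u : L2) :
    reflect N u =ᵐ[torusMeasure] fun x => fourier N x * star (u x) := by
  filter_upwards [coeFn_mulL (fourier N) (star u), Lp.coeFn_star u] with x h1 h2
  rw [reflect, h1, h2]
  rfl

theorem coeff_reflect (N : ℕ) (u : L2) (k : ℤ) :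
    coeff k (reflect N u) = star (coeff (N - k) u) := by
  rw [reflect, coeff_mulL_fourier, coeff_apply, coeff_apply,
    fourierCoeff_congr_ae (Lp.coeFn_star u)]
  unfold fourierCoeff
  rw [Complex.star_def, ← integral_conj]
  refine integral_congr_ae (Eventually.of_forall fun x => ?_)
  simp only [smul_eq_mul, map_mul, ← fourier_neg]
  rw [show -(k - (N : ℤ)) = -(-(N - k)) by ring]
  rfl

theorem norm_reflect (N : ℕ) (u : L2) : ‖reflect N u‖ = ‖u‖ := by
  have h : ∀ᵐ x ∂torusMeasure, ‖reflect N u x‖ = ‖u x‖ := by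
    filter_upwards [coeFn_reflect N u] with x hx
    rw [hx, norm_mul, norm_star, fourier_apply, Circle.norm_coe, one_mul]
  exact le_antisymm (Lp.norm_le_norm_of_ae_le (h.mono fun x hx => hx.le))
    (Lp.norm_le_norm_of_ae_le (h.mono fun x hx => hx.ge))

theorem reflect_mulL_complexify (N : ℕ) (f : C(Torus, ℝ)) (u : L2) :
    reflect N (mulL (complexify f) u) = mulL (complexify f) (reflect N u) := by
  apply Lp.ext
  filter_upwards [coeFn_reflect N (mulL (complexify f) u), coeFn_mulL (complexify f) u,
    coeFn_mulL (complexify f) (reflect N u), coeFn_reflect N u] with x h1 h2 h3 h4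
  rw [h1, h2, h3, h4, complexify_apply, star_mul', Complex.star_def, Complex.conj_ofReal]
  ring

theorem reflect_starProjection (N : ℕ) (u : L2) :
    reflect N ((modes (Set.Icc 0 (N : ℤ))).starProjection u) =
      (modes (Set.Icc 0 (N : ℤ))).starProjection (reflect N u) := by
  refine ext_coeff fun k => ?_
  have : (N : ℤ) - k ∈ Set.Icc 0 (N : ℤ) ↔ k ∈ Set.Icc 0 (N : ℤ) := by
    simp only [Set.mem_Icc]
    omega
  simp only [coeff_reflect, coeff_starProjection, this]
  split_ifs <;> simp

theorem reflect_mem_modes {N : ℕ} {u : L2} (hu : u ∈ modes (Set.Icc 0 (N : ℤ))) :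
    reflect N u ∈ modes (Set.Icc 0 (N : ℤ)) := by
  rw [← Submodule.starProjection_eq_self_iff] at hu ⊢
  rw [← reflect_starProjection, hu]

theorem reflect_smul (N : ℕ) (c : ℂ) (u : L2) : reflect N (c • u) = star c • reflect N u := by
  refine ext_coeff fun k => ?_
  simp [coeff_reflect]

/-- Of a function with frequencies in `{0, …, N}`, the cutoff keeps half of the norm,
either directly or after the reflection. -/
theorem norm_le_norm_cutoff_add_norm_cutoff_reflect {N : ℕ} {u : L2}
    (hu : u ∈ modes (Set.Icc 0 (N : ℤ))) :
    ‖u‖ ≤ ‖cutoff N u‖ + ‖cutoff N (reflect N u)‖ := by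
  have e : cutoff N u + reflect N (cutoff N (reflect N u)) =
      ((1 + ((N : ℝ) + 1)⁻¹ : ℝ) : ℂ) • u := by
    refine ext_coeff fun k => ?_
    rw [map_add, map_smul, coeff_cutoff, coeff_reflect, coeff_cutoff, coeff_reflect]
    simp only [Complex.star_def, map_mul, Complex.conj_ofReal, Complex.conj_conj, sub_sub_cancel]
    by_cases hk : k ∈ Set.Icc 0 (N : ℤ)
    · rw [← cutoffWeight_add_reflect hk.1 hk.2, smul_eq_mul]
      push_cast
      ring
    · simp [mem_modes_iff.1 hu k hk]
  have h := norm_add_le (cutoff N u) (reflect N (cutoff N (reflect N u)))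
  rw [e, norm_reflect, norm_smul, Complex.norm_real, Real.norm_of_nonneg (by positivity)] at h
  have : 0 ≤ ((N : ℝ) + 1)⁻¹ * ‖u‖ := by positivity
  linarith

/-! ### Spectra of products of Toeplitz operators and of their finite sections -/

/-- The cutoff of an eigenvector of a finite section satisfies the eigenvalue equation of the product
of Toeplitz operators up to commutators. -/
theorem norm_cutoff_sub_smul_le (f g : C(Torus, ℝ)) {N : ℕ} {u : L2} (hu : ‖u‖ = 1) {μ : ℂ}
    (h : (modes (Set.Icc 0 (N : ℤ))).starProjection (mulL (complexify f)
      ((modes (Set.Icc 0 (N : ℤ))).starProjection (mulL (complexify g) u))) = μ • u) :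
    ‖(modes (Set.Ici 0)).starProjection (mulL (complexify f)
      ((modes (Set.Ici 0)).starProjection (mulL (complexify g) (cutoff N u)))) - μ • cutoff N u‖ ≤
    ‖mulL (complexify f)‖ * ‖commutator N (complexify g)‖ +
      ‖commutator N (complexify f)‖ * ‖mulL (complexify g)‖ := by
  set P := (modes (Set.Ici 0)).starProjection with hP
  set Q := (modes (Set.Icc 0 (N : ℤ))).starProjection with hQ
  set F := mulL (complexify f) with hF
  set G := mulL (complexify g) with hG
  have hP1 : ∀ v, ‖P v‖ ≤ ‖v‖ := fun v => Submodule.norm_starProjection_apply_le _ v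
  have hQ1 : ∀ v, ‖Q v‖ ≤ ‖v‖ := fun v => Submodule.norm_starProjection_apply_le _ v
  have hcomm : ∀ (φ : C(Torus, ℂ)) (v : L2),
      mulL φ (cutoff N v) = cutoff N (mulL φ v) - commutator N φ v := fun φ v => by
    simp [commutator]
  -- The cutoff is moved to the left through the product; it turns `P` into `Q` on its way.
  have e : P (F (P (G (cutoff N u)))) - μ • cutoff N u =
      -(P (F (P (commutator N (complexify g) u)))) - P (commutator N (complexify f) (Q (G u))) := by
    rw [hG, hcomm, map_sub, map_sub, map_sub, starProjection_Ici_cutoff, cutoff_starProjection_Ici,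
      hF, hcomm, map_sub, starProjection_Ici_cutoff, cutoff_starProjection_Ici, h, map_smul]
    abel
  rw [e]
  refine (norm_sub_le _ _).trans (add_le_add ?_ ?_)
  · rw [norm_neg]
    have h1 := (commutator N (complexify g)).le_opNorm u
    rw [hu, mul_one] at h1
    calc _ ≤ ‖F (P (commutator N (complexify g) u))‖ := hP1 _
      _ ≤ ‖F‖ * ‖P (commutator N (complexify g) u)‖ := F.le_opNorm _
      _ ≤ ‖F‖ * ‖commutator N (complexify g)‖ := by
        gcongr
        exact (hP1 _).trans h1
  · have h1 := G.le_opNorm u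
    rw [hu, mul_one] at h1
    calc _ ≤ ‖commutator N (complexify f) (Q (G u))‖ := hP1 _
      _ ≤ ‖commutator N (complexify f)‖ * ‖Q (G u)‖ := ContinuousLinearMap.le_opNorm _ _
      _ ≤ ‖commutator N (complexify f)‖ * ‖G‖ := by
        gcongr
        exact (hQ1 _).trans h1

/-- An eigenvalue of a finite section, close to the real number `lam`, gives an approximate
eigenvector of the product of Toeplitz operators: an eigenvector `u`, or else its reflection, which
is an eigenvector for the conjugate eigenvalue, has enough mass at low frequencies, and the cutoff
makes an approximate eigenvector of it. -/
theorem exists_approximate_eigenvector (f g : C(Torus, ℝ)) (lam : ℝ) {N : ℕ} {μ : ℂ}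
    (hμ : μ ∈ spectrum ℂ (toeplitzSection N f * toeplitzSection N g)) :
    ∃ w : modes (Set.Ici 0), 1 / 2 ≤ ‖w‖ ∧
      ‖(toeplitz f * toeplitz g) w - (lam : ℂ) • w‖ ≤
        ‖mulL (complexify f)‖ * ‖commutator N (complexify g)‖ +
          ‖commutator N (complexify f)‖ * ‖mulL (complexify g)‖ + ‖μ - lam‖ := by
  obtain ⟨v, hv0, hv⟩ := (mem_spectrum_iff_exists_eigenvector _ _).1 hμ
  have hvn : ‖(v : L2)‖ ≠ 0 := by simpa using hv0
  set u : L2 := ((‖(v : L2)‖⁻¹ : ℝ) : ℂ) • (v : L2) with hu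
  have hun : ‖u‖ = 1 := by
    rw [hu, norm_smul, Complex.norm_real, norm_inv, norm_norm, inv_mul_cancel₀ hvn]
  have hum : u ∈ modes (Set.Icc 0 (N : ℤ)) := Submodule.smul_mem _ _ v.2
  have hv' : (modes (Set.Icc 0 (N : ℤ))).starProjection (mulL (complexify f)
      ((modes (Set.Icc 0 (N : ℤ))).starProjection (mulL (complexify g) v))) = μ • (v : L2) :=
    congr_arg Subtype.val hv
  have hue : (modes (Set.Icc 0 (N : ℤ))).starProjection (mulL (complexify f)
      ((modes (Set.Icc 0 (N : ℤ))).starProjection (mulL (complexify g) u))) = μ • u := by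
    rw [hu]
    simp only [map_smul]
    rw [hv', smul_comm]
  -- It suffices to treat an eigenvector `y` with enough mass at low frequencies.
  have main : ∀ (y : L2) (ν : ℂ), y ∈ modes (Set.Icc 0 (N : ℤ)) → ‖y‖ = 1 →
      (modes (Set.Icc 0 (N : ℤ))).starProjection (mulL (complexify f)
        ((modes (Set.Icc 0 (N : ℤ))).starProjection (mulL (complexify g) y))) = ν • y →
      ‖ν - lam‖ = ‖μ - lam‖ → 1 / 2 ≤ ‖cutoff N y‖ →
      ∃ w : modes (Set.Ici 0), 1 / 2 ≤ ‖w‖ ∧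
        ‖(toeplitz f * toeplitz g) w - (lam : ℂ) • w‖ ≤
          ‖mulL (complexify f)‖ * ‖commutator N (complexify g)‖ +
            ‖commutator N (complexify f)‖ * ‖mulL (complexify g)‖ + ‖μ - lam‖ := by
    intro y ν hy hyn hye hν hhalf
    have hle : y ∈ modes (Set.Ici 0) :=
      mem_modes_iff.2 fun k hk => mem_modes_iff.1 hy k fun hk' => hk hk'.1
    refine ⟨⟨cutoff N y, cutoff_mem_modes N hle⟩, hhalf, ?_⟩
    rw [toeplitz, toeplitz, norm_compression_mul_sub_smul]
    refine (norm_sub_le_norm_sub_add_norm_sub _ (ν • cutoff N y) _).trans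
      (add_le_add (norm_cutoff_sub_smul_le f g hyn hye) ?_)
    rw [← sub_smul, norm_smul, hν]
    refine mul_le_of_le_one_right (norm_nonneg _) ?_
    refine ((cutoff N).le_opNorm y).trans ?_
    rw [hyn, mul_one]
    exact norm_cutoff_le N
  rcases le_total (1 / 2) ‖cutoff N u‖ with h | h
  · exact main u μ hum hun hue rfl h
  · refine main (reflect N u) (star μ) (reflect_mem_modes hum) (by rw [norm_reflect, hun]) ?_ ?_ ?_
    · rw [← reflect_mulL_complexify, ← reflect_starProjection, ← reflect_mulL_complexify,
        ← reflect_starProjection, hue, reflect_smul]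
    · rw [← norm_star (μ - lam), star_sub, Complex.star_def, Complex.conj_ofReal]
    · have := norm_le_norm_cutoff_add_norm_cutoff_reflect hum
      rw [hun] at this
      linarith

/-- Limits of eigenvalues of the finite sections, along any sequence of sizes, lie in the spectrum
of the product of Toeplitz operators. No sign condition on the symbols is needed. -/
theorem mem_spectrum_of_tendsto (f g : C(Torus, ℝ)) (lam : ℝ) {N : ℕ → ℕ} (hN : StrictMono N)
    {μ : ℕ → ℂ}
    (hμ : ∀ k, μ k ∈ spectrum ℂ (toeplitzSection (N k) f * toeplitzSection (N k) g))
    (hlim : Tendsto μ atTop (𝓝 (lam : ℂ))) :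
    (lam : ℂ) ∈ spectrum ℂ (toeplitz f * toeplitz g) := by
  by_contra hlam
  rw [spectrum.notMem_iff] at hlam
  obtain ⟨c, hc, hbd⟩ := exists_pos_mul_norm_le_of_isUnit hlam
  have hε : Tendsto (fun k => ‖mulL (complexify f)‖ * ‖commutator (N k) (complexify g)‖ +
      ‖commutator (N k) (complexify f)‖ * ‖mulL (complexify g)‖ + ‖μ k - lam‖) atTop (𝓝 0) := by
    have h1 := (tendsto_norm_commutator (complexify g)).comp hN.tendsto_atTop
    have h2 := (tendsto_norm_commutator (complexify f)).comp hN.tendsto_atTop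
    have h3 : Tendsto (fun k => ‖μ k - lam‖) atTop (𝓝 0) := by
      simpa using (hlim.sub_const (lam : ℂ)).norm
    have h := ((h1.const_mul ‖mulL (complexify f)‖).add
      (h2.mul_const ‖mulL (complexify g)‖)).add h3
    simpa using h
  obtain ⟨k, hk⟩ := (hε.eventually (gt_mem_nhds (show 0 < c * (1 / 2) by positivity))).exists
  obtain ⟨w, hw, hwe⟩ := exists_approximate_eigenvector f g lam (hμ k)
  have h1 := hbd w
  rw [algebraMap_sub_apply, norm_neg] at h1
  have h2 : c * (1 / 2) ≤ c * ‖w‖ := by gcongr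
  linarith

/-- The finite sections converge strongly, so that lower bounds which hold for infinitely many of
them pass to the limit. -/
theorem mul_norm_le_of_frequently (f g : C(Torus, ℝ)) (z : ℂ) (c : ℝ)
    (h : ∃ᶠ n in atTop, ∀ x, c * ‖x‖ ≤
      ‖(toeplitzSection n f * toeplitzSection n g) x - z • x‖) (x : modes (Set.Ici 0)) :
    c * ‖x‖ ≤ ‖(toeplitz f * toeplitz g) x - z • x‖ := by
  have hconv : ∀ (v : ℕ → L2) (w : L2), Tendsto v atTop (𝓝 w) →
      Tendsto (fun n : ℕ => (modes (Set.Icc 0 (n : ℤ))).starProjection (v n)) atTop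
        (𝓝 ((modes (Set.Ici 0)).starProjection w)) := by
    intro v w hv
    have h1 : Tendsto (fun n : ℕ => (modes (Set.Icc 0 (n : ℤ))).starProjection (v n - w)) atTop
        (𝓝 0) := by
      refine squeeze_zero_norm (fun n => Submodule.norm_starProjection_apply_le _ _) ?_
      simpa using (hv.sub_const w).norm
    simpa using h1.add (tendsto_starProjection_modes_Icc w)
  have hx : (modes (Set.Ici 0)).starProjection (x : L2) = x :=
    Submodule.starProjection_eq_self_iff.2 x.2
  have h0 := hconv _ _ (tendsto_const_nhds (x := (x : L2)))
  have h1 := hconv _ _ (((mulL (complexify g)).continuous.tendsto _).comp h0)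
  have h2 := hconv _ _ (((mulL (complexify f)).continuous.tendsto _).comp h1)
  rw [hx] at h0 h1 h2
  have h4 : ∃ᶠ n : ℕ in atTop, c * ‖(modes (Set.Icc 0 (n : ℤ))).starProjection (x : L2)‖ ≤
      ‖(modes (Set.Icc 0 (n : ℤ))).starProjection (mulL (complexify f)
        ((modes (Set.Icc 0 (n : ℤ))).starProjection (mulL (complexify g)
          ((modes (Set.Icc 0 (n : ℤ))).starProjection (x : L2))))) -
        z • (modes (Set.Icc 0 (n : ℤ))).starProjection (x : L2)‖ := by
    refine h.mono fun n hn => ?_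
    have h5 := hn ((modes (Set.Icc 0 (n : ℤ))).orthogonalProjectionOnto (x : L2))
    rw [toeplitzSection, toeplitzSection, norm_compression_mul_sub_smul,
      Submodule.coe_norm, Submodule.coe_orthogonalProjectionOnto_apply] at h5
    exact h5
  rw [toeplitz, toeplitz, norm_compression_mul_sub_smul]
  refine le_of_tendsto_of_tendsto_of_frequently (h0.norm.const_mul c) ?_ h4
  exact (h2.sub (h0.const_smul z)).norm

/-- The spectrum of the product of Toeplitz operators is approximated by the spectra of the finite
sections. -/
theorem exists_tendsto_of_mem_spectrum (f g : C(Torus, ℝ)) (hg : ∀ x, 0 ≤ g x) (lam : ℝ)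
    (hlam : (lam : ℂ) ∈ spectrum ℂ (toeplitz f * toeplitz g)) :
    ∃ μ : ℕ → ℂ, (∀ n : ℕ, μ n ∈ spectrum ℂ (toeplitzSection n f * toeplitzSection n g)) ∧
      Tendsto μ atTop (𝓝 (lam : ℂ)) := by
  -- The eigenvalue closest to `lam` is chosen for each section.
  choose μ hμ hmin using fun n : ℕ =>
    exists_closest_mem_spectrum (toeplitzSection n f * toeplitzSection n g) (lam : ℂ)
  refine ⟨μ, hμ, ?_⟩
  by_contra hnot
  rw [Metric.tendsto_nhds] at hnot
  push Not at hnot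
  obtain ⟨δ, hδ, hfreq⟩ := hnot
  obtain ⟨c, hc, hbd⟩ := exists_pos_forall_mul_norm_le_mul_sub_smul (lam : ℂ)
    ‖mulL (complexify f)‖ ‖mulL (complexify g)‖ hδ
  have hsa : ∀ n h, IsSelfAdjoint (toeplitzSection n h) := fun n h =>
    isSelfAdjoint_compression _ h
  have hfg : ∃ᶠ n in atTop, ∀ x, c * ‖x‖ ≤
      ‖(toeplitzSection n f * toeplitzSection n g) x - (lam : ℂ) • x‖ :=
    hfreq.mono fun n hn => hbd _ _ _ (hsa n f) (isPositive_compression _ hg)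
      (norm_compression_le _ f) (norm_compression_le _ g) fun θ hθ =>
        ((dist_eq_norm (μ n) (lam : ℂ)) ▸ hn).trans (hmin n θ hθ)
  have hgf : ∃ᶠ n in atTop, ∀ x, c * ‖x‖ ≤
      ‖(toeplitzSection n g * toeplitzSection n f) x - (lam : ℂ) • x‖ :=
    hfg.mono fun n hn => mul_norm_le_mul_comm_sub_smul (hsa n f) (hsa n g) hc hn
  exact notMem_spectrum_mul (isSelfAdjoint_compression _ f) (isSelfAdjoint_compression _ g) hc
    (mul_norm_le_of_frequently f g lam c hfg) (mul_norm_le_of_frequently g f lam c hgf) hlam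

end ToeplitzProduct

theorem theorem2 (f g : C(ToeplitzProduct.Torus, ℝ)) (hg : ∀ x, 0 ≤ g x) (lam : ℝ) :
    List.TFAE [
      (lam : ℂ) ∈ spectrum ℂ (ToeplitzProduct.toeplitz f * ToeplitzProduct.toeplitz g),
      ∃ μ : ℕ → ℂ,
        (∀ n : ℕ, μ n ∈ spectrum ℂ
          (ToeplitzProduct.toeplitzSection n f * ToeplitzProduct.toeplitzSection n g)) ∧
        Tendsto μ atTop (𝓝 (lam : ℂ)),
      ∃ N : ℕ → ℕ, StrictMono N ∧ ∃ μ : ℕ → ℂ,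
        (∀ k : ℕ, μ k ∈ spectrum ℂ
          (ToeplitzProduct.toeplitzSection (N k) f * ToeplitzProduct.toeplitzSection (N k) g)) ∧
        Tendsto μ atTop (𝓝 (lam : ℂ))] := by
  tfae_have 1 → 2 := ToeplitzProduct.exists_tendsto_of_mem_spectrum f g hg lam
  tfae_have 2 → 3 := fun ⟨μ, hμ, hlim⟩ => ⟨id, strictMono_id, μ, hμ, hlim⟩
  tfae_have 3 → 1 := fun ⟨_, hN, _, hμ, hlim⟩ =>
    ToeplitzProduct.mem_spectrum_of_tendsto f g lam hN hμ hlim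
  tfae_finish
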